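/- Let $A=(a_n(i))_{n,i\in\mathbb N}$ be a Köthe matrix (that is, $0\le a_n(i)\le a_{n+1}(i)$ for all $n,i$, and for every $i$ there is $n$ with $a_n(i)>0$) such that (G1-1) $0<a_n(i+1)\le a_n(i)$ for all $n,i\in\mathbb N$, and (G1-2) for every $n$ there are $m>n$ and $C>0$ with $a_n(i)\le C\,a_m(i)^2$ for all $i\in\mathbb N$. Let $\lambda_0(A)=\{x\in\mathbb C^{\mathbb N}:\lim_{i\to\infty} a_n(i)x_i=0\ \text{for all } n\in\mathbb N\}$ be the associated Köthe echelon space of order $0$, with the Fréchet topology given by the seminorms $p_n(x)=\sup_i a_n(i)|x_i|$, $n\in\mathbb N$ (a $G_1$-space), and let $\mathsf C\colon\lambda_0(A)\to\lambda_0(A)$ be the Cesàro operator, $(\mathsf Cx)_i=\frac1i\sum_{j=1}^i x_j$, which is well defined and continuous. If the locally convex space $\lambda_0(A)$ is nuclear, then for every $m\in\mathbb N$ the range $(I-\mathsf C)^m(\lambda_0(A))$ is a closed subspace of $\lambda_0(A)$. -/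

import Mathlib

open Filter Topology

/-! ### Nuclear operators and nuclear spaces -/

section Nuclear

/-- A continuous linear operator `T : X → Y` between (semi)normed spaces is nuclear if
`T x = ∑ₖ fₖ(x) yₖ` for all `x`, where `fₖ ∈ X'`, `yₖ ∈ Y` and `∑ₖ ‖fₖ‖ ‖yₖ‖ < ∞`. -/
def IsNuclearOperator {𝕜 X Y : Type*} [RCLike 𝕜]
    [SeminormedAddCommGroup X] [NormedSpace 𝕜 X] [SeminormedAddCommGroup Y] [NormedSpace 𝕜 Y]
    (T : X →L[𝕜] Y) : Prop :=
  ∃ (f : ℕ → (X →L[𝕜] 𝕜)) (y : ℕ → Y),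
    Summable (fun k => ‖f k‖ * ‖y k‖) ∧ ∀ x, HasSum (fun k => f k x • y k) (T x)

variable {𝕜 E : Type*} [RCLike 𝕜] [AddCommGroup E] [Module 𝕜 E]

/-- The vector space `E` regarded as a seminormed space with the seminorm `p`. -/
def SeminormedBy (_p : Seminorm 𝕜 E) : Type _ := E

instance (p : Seminorm 𝕜 E) : SeminormedAddCommGroup (SeminormedBy p) :=
  p.toAddGroupSeminorm.toSeminormedAddCommGroup

instance (p : Seminorm 𝕜 E) : Module 𝕜 (SeminormedBy p) :=
  inferInstanceAs (Module 𝕜 E)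

instance (p : Seminorm 𝕜 E) : NormedSpace 𝕜 (SeminormedBy p) where
  norm_smul_le c x := (map_smul_eq_mul p c x).le

/-- The local Banach space `E_p` of the seminorm `p`: the Hausdorff completion of `(E, p)`, that is,
the completion of the normed space `E / ker p`. -/
abbrev LocalBanachSpace (p : Seminorm 𝕜 E) : Type _ :=
  UniformSpace.Completion (SeminormedBy p)

/-- For `p ≤ q`, the identity `(E, q) → (E, p)`. -/
noncomputable def seminormedId (p q : Seminorm 𝕜 E) (h : p ≤ q) :
    SeminormedBy q →L[𝕜] SeminormedBy p :=
  LinearMap.mkContinuous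
    ({ toFun := fun x => x, map_add' := fun _ _ => rfl, map_smul' := fun _ _ => rfl } :
      SeminormedBy q →ₗ[𝕜] SeminormedBy p) 1
    (fun x => (h x).trans (one_mul (q x)).ge)

/-- For `p ≤ q`, the canonical linking map `E_q → E_p` between the local Banach spaces. -/
noncomputable def linkingMap (p q : Seminorm 𝕜 E) (h : p ≤ q) :
    LocalBanachSpace q →L[𝕜] LocalBanachSpace p :=
  (seminormedId p q h).completion

variable (𝕜 E) in
/-- A locally convex space `E` is nuclear if for every continuous seminorm `p` there is a
continuous seminorm `q ≥ p` such that the linking map `E_q → E_p` is nuclear. -/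
def IsNuclearSpace [TopologicalSpace E] [PolynormableSpace 𝕜 E] : Prop :=
  ∀ p : Seminorm 𝕜 E, Continuous p →
    ∃ (q : Seminorm 𝕜 E) (h : p ≤ q), Continuous q ∧ IsNuclearOperator (linkingMap p q h)

end Nuclear

/-! ### Köthe matrices and Köthe echelon spaces of order zero

Sequences are indexed by `0, 1, 2, …`: the entry `a n i` is the one usually written `a_{n+1}(i+1)`,
and `x i` is the coordinate usually written `x_{i+1}`. -/

/-- `a` is a Köthe matrix. -/
structure IsKotheMatrix (a : ℕ → ℕ → ℝ) : Prop where
  nonneg : ∀ n i, 0 ≤ a n i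
  mono : ∀ n i, a n i ≤ a (n + 1) i
  exists_pos : ∀ i, ∃ n, 0 < a n i

/-- `a` is a Köthe matrix satisfying (G1-1) and (G1-2), i.e. its echelon space of order zero is a
smooth sequence space of finite type (a `G₁`-space). -/
structure IsG1Matrix (a : ℕ → ℕ → ℝ) : Prop extends IsKotheMatrix a where
  pos : ∀ n i, 0 < a n (i + 1)
  anti : ∀ n i, a n (i + 1) ≤ a n i
  le_sq : ∀ n, ∃ m, n < m ∧ ∃ C : ℝ, 0 < C ∧ ∀ i, a n i ≤ C * a m i ^ 2

/-- The sequences `x` with `aₙ(i) xᵢ → 0` for every `n`. -/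
def kotheSubmodule (a : ℕ → ℕ → ℝ) : Submodule ℂ (ℕ → ℂ) where
  carrier := {x | ∀ n, Tendsto (fun i => (a n i : ℂ) * x i) atTop (𝓝 0)}
  zero_mem' n := by simp
  add_mem' {x y} hx hy n := by simpa [mul_add] using (hx n).add (hy n)
  smul_mem' c x hx n := by simpa [mul_left_comm] using (hx n).const_mul c

/-- The Köthe echelon space `λ₀(A)` of order zero. It is a type of its own because its
topology is not the one induced by the product `ℂ^ℕ`. -/
def KotheSpace (a : ℕ → ℕ → ℝ) : Type := kotheSubmodule a

namespace KotheSpace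

variable {a : ℕ → ℕ → ℝ}

instance : AddCommGroup (KotheSpace a) := inferInstanceAs (AddCommGroup (kotheSubmodule a))

instance : Module ℂ (KotheSpace a) := inferInstanceAs (Module ℂ (kotheSubmodule a))

/-- The inclusion of `λ₀(A)` into `ℂ^ℕ`. -/
def toSeq : KotheSpace a →ₗ[ℂ] (ℕ → ℂ) := (kotheSubmodule a).subtype

theorem tendsto (x : KotheSpace a) (n : ℕ) :
    Tendsto (fun i => (a n i : ℂ) * toSeq x i) atTop (𝓝 0) := x.2 n

theorem bddAbove (x : KotheSpace a) (n : ℕ) :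
    BddAbove (Set.range fun i => ‖(a n i : ℂ) * toSeq x i‖) :=
  (tendsto x n).norm.bddAbove_range

/-- The seminorm `pₙ(x) = supᵢ aₙ(i) |xᵢ|` (the supremum is finite by `bddAbove`). -/
noncomputable def seminorm (a : ℕ → ℕ → ℝ) (n : ℕ) : Seminorm ℂ (KotheSpace a) :=
  Seminorm.of (fun x => ⨆ i, ‖(a n i : ℂ) * toSeq x i‖)
    (fun x y => ciSup_le fun i => by
      have hx := le_ciSup (bddAbove x n) i
      have hy := le_ciSup (bddAbove y n) i
      have h := norm_add_le ((a n i : ℂ) * toSeq x i) ((a n i : ℂ) * toSeq y i)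
      simp only [map_add, Pi.add_apply, mul_add]
      linarith)
    (fun c x => by
      rw [Real.mul_iSup_of_nonneg (norm_nonneg c)]
      simp [mul_left_comm])

theorem seminorm_apply (n : ℕ) (x : KotheSpace a) :
    seminorm a n x = ⨆ i, ‖(a n i : ℂ) * toSeq x i‖ := rfl

/-- The topology of `λ₀(A)` is generated by the seminorms `pₙ`. -/
noncomputable instance : TopologicalSpace (KotheSpace a) :=
  SeminormFamily.moduleFilterBasis (𝕜 := ℂ) (fun n => seminorm a n) |>.topology

theorem withSeminorms (a : ℕ → ℕ → ℝ) :
    WithSeminorms (fun n => seminorm a n : SeminormFamily ℂ (KotheSpace a) ℕ) := ⟨rfl⟩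

instance : IsTopologicalAddGroup (KotheSpace a) := (withSeminorms a).topologicalAddGroup

instance : ContinuousSMul ℂ (KotheSpace a) := (withSeminorms a).continuousSMul

instance : PolynormableSpace ℂ (KotheSpace a) := (withSeminorms a).toPolynormableSpace

end KotheSpace

/-! ### The discrete Cesàro operator -/

/-- The Cesàro operator on `ℂ^ℕ`. -/
noncomputable def cesaroSeq : (ℕ → ℂ) →ₗ[ℂ] (ℕ → ℂ) where
  toFun x i := (∑ j ∈ Finset.range (i + 1), x j) / ((i : ℂ) + 1)
  map_add' x y := by
    funext i
    simp [Finset.sum_add_distrib, add_div]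
  map_smul' c x := by
    funext i
    simp [← Finset.mul_sum, mul_div_assoc]

theorem IsG1Matrix.anti' {a : ℕ → ℕ → ℝ} (h : IsG1Matrix a) (n : ℕ) : Antitone (a n) :=
  antitone_nat_of_succ_le (h.anti n)

theorem IsG1Matrix.norm_cesaroSeq_le {a : ℕ → ℕ → ℝ} (h : IsG1Matrix a) (n i : ℕ) (x : ℕ → ℂ) :
    ‖(a n i : ℂ) * cesaroSeq x i‖ ≤
      ((i + 1 : ℕ) : ℝ)⁻¹ * ∑ j ∈ Finset.range (i + 1), ‖(a n j : ℂ) * x j‖ := by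
  have hn : ‖(i : ℂ) + 1‖ = ((i + 1 : ℕ) : ℝ) := by
    rw [← Nat.cast_succ, Complex.norm_natCast]
  have h1 : a n i * ‖∑ j ∈ Finset.range (i + 1), x j‖ ≤
      ∑ j ∈ Finset.range (i + 1), ‖(a n j : ℂ) * x j‖ := by
    refine (mul_le_mul_of_nonneg_left (norm_sum_le _ _) (h.nonneg n i)).trans ?_
    rw [Finset.mul_sum]
    refine Finset.sum_le_sum fun j hj => ?_
    rw [norm_mul, Complex.norm_real, Real.norm_of_nonneg (h.nonneg n j)]
    exact mul_le_mul_of_nonneg_right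
      (h.anti' n (Nat.lt_succ_iff.mp (Finset.mem_range.mp hj))) (norm_nonneg _)
  have h2 : ‖(a n i : ℂ) * cesaroSeq x i‖ =
      ((i + 1 : ℕ) : ℝ)⁻¹ * (a n i * ‖∑ j ∈ Finset.range (i + 1), x j‖) := by
    change ‖(a n i : ℂ) * ((∑ j ∈ Finset.range (i + 1), x j) / ((i : ℂ) + 1))‖ = _
    rw [norm_mul, norm_div, hn, Complex.norm_real, Real.norm_of_nonneg (h.nonneg n i)]
    ring
  rw [h2]
  exact mul_le_mul_of_nonneg_left h1 (by positivity)

theorem IsG1Matrix.cesaroSeq_mem {a : ℕ → ℕ → ℝ} (h : IsG1Matrix a) {x : ℕ → ℂ}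
    (hx : x ∈ kotheSubmodule a) : cesaroSeq x ∈ kotheSubmodule a := by
  intro n
  have h1 := ((tendsto_zero_iff_norm_tendsto_zero.mp (hx n)).cesaro).comp (tendsto_add_atTop_nat 1)
  exact squeeze_zero_norm (fun i => h.norm_cesaroSeq_le n i x) h1

/-- The Cesàro operator `C : λ₀(A) → λ₀(A)`, the restriction of the one on `ℂ^ℕ`. -/
noncomputable def cesaro (a : ℕ → ℕ → ℝ) (h : IsG1Matrix a) : KotheSpace a →L[ℂ] KotheSpace a where
  toLinearMap := cesaroSeq.restrict (p := kotheSubmodule a) (q := kotheSubmodule a)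
    fun _ hx => h.cesaroSeq_mem hx
  cont := by
    refine WithSeminorms.continuous_of_isBounded (KotheSpace.withSeminorms a)
      (KotheSpace.withSeminorms a) _ fun n => ⟨{n}, 1, fun x => ?_⟩
    simp only [Finset.sup_singleton, one_smul]
    refine ciSup_le fun i => (h.norm_cesaroSeq_le n i (KotheSpace.toSeq x)).trans ?_
    rw [inv_mul_le_iff₀ (by positivity)]
    refine (Finset.sum_le_card_nsmul _ _ (KotheSpace.seminorm a n x)
      fun j _ => le_ciSup (KotheSpace.bddAbove x n) j).trans ?_
    simp

theorem toSeq_cesaro {a : ℕ → ℕ → ℝ} (h : IsG1Matrix a) (x : KotheSpace a) (i : ℕ) :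
    KotheSpace.toSeq (cesaro a h x) i =
      (∑ j ∈ Finset.range (i + 1), KotheSpace.toSeq x j) / ((i : ℂ) + 1) := rfl

/-!
The proof rests on the description of the range of `I - C` on a nuclear `G₁`-space as the closed
hyperplane `{y | y 0 = 0}`.

Nuclearity enters through the Grothendieck–Pietsch estimate `sum_div_le_of_isNuclearSpace`: the
sums `∑ᵢ aₙ(i) / aₘ(i)` are bounded for some `m`. To see this, expand the linking map as
`∑ₖ fₖ ⊗ yₖ`, so that `aₙ(i)`, the norm of the `i`-th unit vector in the target, is at most
`∑ₖ |fₖ(eᵢ)| ‖yₖ‖`; and `∑ᵢ |fₖ(eᵢ)| / aₘ(i)` is at most a constant times `‖fₖ‖`, by testing `fₖ` on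
finitely supported vectors with suitable phases. Since the rows of the matrix decrease, it follows
that `(i + 1) aₙ(i)` is bounded, and the condition `aₙ ≤ C aₘ²` improves this to
`(i + 1) aₙ(i) ≤ K aₘ(i)` (`exists_succ_mul_le`).

If `y 0 = 0`, the equation `x - C x = y` has the solution `xᵢ = yᵢ + ∑_{1 ≤ j ≤ i} yⱼ / j` in `ℂ^ℕ`,
and the last estimate bounds `aₙ(i) |∑ⱼ yⱼ / j|` by the Cesàro means of the null sequence
`aₘ(j) |yⱼ|`, so the solution lies in the space. It again satisfies `x 0 = 0`. Hence `I - C` maps the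
hyperplane onto itself, and the range of each positive power of `I - C` is this hyperplane.
-/

/-! ### Unit vectors and coordinates -/

namespace KotheSpace

variable {a : ℕ → ℕ → ℝ}

/-- The `i`-th unit vector of `λ₀(A)`. -/
def unitVector (a : ℕ → ℕ → ℝ) (i : ℕ) : KotheSpace a :=
  ⟨Pi.single i 1, fun n => tendsto_const_nhds.congr' <| by
    filter_upwards [eventually_gt_atTop i] with j hj
    simp [Pi.single_eq_of_ne hj.ne']⟩

theorem toSeq_unitVector (i : ℕ) : toSeq (unitVector a i) = Pi.single i 1 := rfl

theorem toSeq_injective : Function.Injective (toSeq : KotheSpace a →ₗ[ℂ] (ℕ → ℂ)) :=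
  Subtype.coe_injective

theorem norm_mul_toSeq_le_seminorm (n : ℕ) (x : KotheSpace a) (i : ℕ) :
    ‖(a n i : ℂ) * toSeq x i‖ ≤ seminorm a n x :=
  le_ciSup (bddAbove x n) i

theorem seminorm_sum_smul_unitVector_le (m : ℕ) (s : Finset ℕ) (c : ℕ → ℂ)
    (hc : ∀ i, ‖(a m i : ℂ) * c i‖ ≤ 1) :
    seminorm a m (∑ i ∈ s, c i • unitVector a i) ≤ 1 := by
  refine ciSup_le fun i => ?_
  have h : toSeq (∑ j ∈ s, c j • unitVector a j) i = if i ∈ s then c i else 0 := by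
    simp [toSeq_unitVector, Finset.sum_apply, Pi.single_apply]
  rw [h]
  split_ifs
  · exact hc i
  · simp

/-- Functionals bounded by `pₘ` have `ℓ¹`-coefficients with respect to the weight `1 / aₘ`. -/
theorem sum_norm_unitVector_div_le (m : ℕ) (hpos : ∀ i, 0 < a m i) (g : KotheSpace a →ₗ[ℂ] ℂ)
    (M : ℝ) (hM : 0 ≤ M) (hg : ∀ x, ‖g x‖ ≤ M * seminorm a m x) (s : Finset ℕ) :
    ∑ i ∈ s, ‖g (unitVector a i)‖ / a m i ≤ M := by
  -- The phase `u i` aligns the `i`-th coefficient of `g` with the positive real axis.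
  choose u hu hgu using fun i => RCLike.exists_norm_eq_mul_self (g (unitVector a i))
  have hne : ∀ i, (a m i : ℂ) ≠ 0 := fun i => Complex.ofReal_ne_zero.mpr (hpos i).ne'
  have hx := seminorm_sum_smul_unitVector_le m s (fun i => u i / (a m i : ℂ)) fun i => by
    rw [mul_div_cancel₀ _ (hne i), hu]
  have hval : g (∑ i ∈ s, (u i / (a m i : ℂ)) • unitVector a i) =
      ((∑ i ∈ s, ‖g (unitVector a i)‖ / a m i : ℝ) : ℂ) := by
    rw [map_sum, Complex.ofReal_sum]
    refine Finset.sum_congr rfl fun i _ => ?_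
    have := hgu i
    rw [map_smul, smul_eq_mul, Complex.ofReal_div, div_mul_eq_mul_div]
    congr 1
    exact this.symm
  calc ∑ i ∈ s, ‖g (unitVector a i)‖ / a m i
      ≤ ‖((∑ i ∈ s, ‖g (unitVector a i)‖ / a m i : ℝ) : ℂ)‖ := by
        rw [Complex.norm_real]; exact le_abs_self _
    _ ≤ M * seminorm a m (∑ i ∈ s, (u i / (a m i : ℂ)) • unitVector a i) := hval ▸ hg _
    _ ≤ M := mul_le_of_le_one_right hM hx

theorem monotone_seminorm (ha : IsKotheMatrix a) : Monotone (seminorm a) := by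
  refine monotone_nat_of_le_succ fun n x => ciSup_le fun i =>
    le_trans ?_ (norm_mul_toSeq_le_seminorm (n + 1) x i)
  simp only [norm_mul, Complex.norm_real, Real.norm_of_nonneg (ha.nonneg _ _)]
  exact mul_le_mul_of_nonneg_right (ha.mono n i) (norm_nonneg _)

theorem exists_le_mul_seminorm (ha : IsKotheMatrix a) (q : Seminorm ℂ (KotheSpace a))
    (hq : Continuous q) : ∃ (m : ℕ) (C : ℝ), 0 ≤ C ∧ ∀ x, q x ≤ C * seminorm a m x := by
  obtain ⟨s, C, -, h⟩ := Seminorm.bound_of_continuous (withSeminorms a) q hq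
  refine ⟨s.sup id, C, C.2, fun x => (h x).trans ?_⟩
  refine mul_le_mul_of_nonneg_left ?_ C.2
  exact Seminorm.le_def.mp
    (Finset.sup_le fun i hi => monotone_seminorm ha (Finset.le_sup (f := id) hi)) x

theorem continuous_seminorm (a : ℕ → ℕ → ℝ) (n : ℕ) : Continuous (seminorm a n) :=
  (withSeminorms a).continuous_seminorm n

theorem continuous_toSeq_apply {n i : ℕ} (hpos : 0 < a n i) :
    Continuous fun x : KotheSpace a => toSeq x i := by
  let f : KotheSpace a →ₗ[ℂ] ℂ := (LinearMap.proj i).comp toSeq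
  refine WithSeminorms.continuous_of_isBounded (withSeminorms a) (norm_withSeminorms ℂ ℂ) f
    fun _ => ⟨{n}, ⟨(a n i)⁻¹, by positivity⟩, fun x => ?_⟩
  have h := norm_mul_toSeq_le_seminorm n x i
  rw [norm_mul, Complex.norm_real, Real.norm_of_nonneg hpos.le] at h
  simp only [Finset.sup_singleton]
  change ‖toSeq x i‖ ≤ (a n i)⁻¹ * seminorm a n x
  rwa [le_inv_mul_iff₀ hpos]

/-! ### The consequence of nuclearity -/

/-- The canonical map from `λ₀(A)` to the local Banach space of a seminorm. -/
noncomputable def toLocal (q : Seminorm ℂ (KotheSpace a)) : KotheSpace a →ₗ[ℂ] LocalBanachSpace q :=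
  (UniformSpace.Completion.toComplL (𝕜 := ℂ) (E := SeminormedBy q)).toLinearMap

theorem norm_toLocal (q : Seminorm ℂ (KotheSpace a)) (x : KotheSpace a) : ‖toLocal q x‖ = q x :=
  UniformSpace.Completion.norm_coe (E := SeminormedBy q) x

theorem linkingMap_toLocal (p q : Seminorm ℂ (KotheSpace a)) (h : p ≤ q) (x : KotheSpace a) :
    linkingMap p q h (toLocal q x) = toLocal p x :=
  ContinuousLinearMap.completion_apply_coe (seminormedId p q h) x

/-- The `i`-th coordinate, weighted by `aₙ(i)`, as a functional on the space seminormed by `pₙ`. -/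
noncomputable def weightedCoord (a : ℕ → ℕ → ℝ) (n i : ℕ) : SeminormedBy (seminorm a n) →L[ℂ] ℂ :=
  LinearMap.mkContinuous
    ((a n i : ℂ) • ((LinearMap.proj i).comp toSeq : KotheSpace a →ₗ[ℂ] ℂ) :
      SeminormedBy (seminorm a n) →ₗ[ℂ] ℂ) 1
    fun x => (norm_mul_toSeq_le_seminorm n x i).trans (one_mul (seminorm a n x)).ge

theorem weightedCoord_fromCompletion_toLocal (n i : ℕ) (x : KotheSpace a) :
    (weightedCoord a n i).fromCompletion (toLocal (seminorm a n) x) = (a n i : ℂ) * toSeq x i :=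
  ContinuousLinearMap.fromCompletion_apply_coe (weightedCoord a n i) x

theorem norm_weightedCoord_fromCompletion_le (n i : ℕ) (y : LocalBanachSpace (seminorm a n)) :
    ‖(weightedCoord a n i).fromCompletion y‖ ≤ ‖y‖ := by
  induction y using UniformSpace.Completion.induction_on with
  | hp => exact isClosed_le (by fun_prop) continuous_norm
  | ih x =>
    refine (congrArg norm (weightedCoord_fromCompletion_toLocal n i x)).trans_le ?_
    exact (norm_mul_toSeq_le_seminorm n x i).trans_eq (norm_toLocal _ x).symm

/-- A nuclear expansion of the linking map dominates the weights: the linking map fixes the `i`-th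
unit vector, whose weighted `i`-th coordinate is `aₙ(i)`, and weighted coordinates have norm at
most one. -/
theorem le_tsum_of_hasSum_linkingMap (n : ℕ) (hnn : ∀ i, 0 ≤ a n i)
    (q : Seminorm ℂ (KotheSpace a)) (h : seminorm a n ≤ q)
    (f : ℕ → (LocalBanachSpace q →L[ℂ] ℂ)) (y : ℕ → LocalBanachSpace (seminorm a n))
    (hT : ∀ x, HasSum (fun k => f k x • y k) (linkingMap (seminorm a n) q h x)) (i : ℕ)
    (hs : Summable fun k => ‖f k (toLocal q (unitVector a i))‖ * ‖y k‖) :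
    a n i ≤ ∑' k, ‖f k (toLocal q (unitVector a i))‖ * ‖y k‖ := by
  have hsum := (hT (toLocal q (unitVector a i))).mapL (weightedCoord a n i).fromCompletion
  rw [linkingMap_toLocal, weightedCoord_fromCompletion_toLocal, toSeq_unitVector,
    Pi.single_eq_same, mul_one] at hsum
  have hnorm : ‖(a n i : ℂ)‖ = a n i := by rw [Complex.norm_real, Real.norm_of_nonneg (hnn i)]
  rw [← hnorm]
  refine hsum.norm_le_of_bounded hs.hasSum fun k => ?_
  rw [map_smul, norm_smul]
  gcongr
  exact norm_weightedCoord_fromCompletion_le n i (y k)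

/-- One half of the Grothendieck–Pietsch criterion. -/
theorem sum_div_le_of_isNuclearSpace (ha : IsKotheMatrix a) (hpos : ∀ n i, 0 < a n i)
    (hnuc : IsNuclearSpace ℂ (KotheSpace a)) (n : ℕ) :
    ∃ (m : ℕ) (K : ℝ), ∀ s : Finset ℕ, ∑ i ∈ s, a n i / a m i ≤ K := by
  obtain ⟨q, hle, hq, f, y, hs, hT⟩ := hnuc (seminorm a n) (continuous_seminorm a n)
  obtain ⟨m, C, hC, hqm⟩ := exists_le_mul_seminorm ha q hq
  let e : ℕ → LocalBanachSpace q := fun i => toLocal q (unitVector a i)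
  have hfe : ∀ k i, ‖f k (e i)‖ ≤ ‖f k‖ * ‖e i‖ := fun k i => (f k).le_opNorm _
  have hsum : ∀ i, Summable fun k => ‖f k (e i)‖ * ‖y k‖ := fun i =>
    Summable.of_nonneg_of_le (fun k => by positivity)
      (fun k => by
        calc ‖f k (e i)‖ * ‖y k‖ ≤ (‖f k‖ * ‖e i‖) * ‖y k‖ := by gcongr; exact hfe k i
          _ = ‖e i‖ * (‖f k‖ * ‖y k‖) := by ring) (hs.mul_left ‖e i‖)
  have hdom : ∀ i, a n i ≤ ∑' k, ‖f k (e i)‖ * ‖y k‖ := fun i =>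
    le_tsum_of_hasSum_linkingMap n (ha.nonneg n) q hle f y hT i (hsum i)
  have hcoef : ∀ (k : ℕ) (s : Finset ℕ), ∑ i ∈ s, ‖f k (e i)‖ / a m i ≤ ‖f k‖ * C := by
    intro k s
    refine sum_norm_unitVector_div_le m (hpos m) ((f k).toLinearMap ∘ₗ toLocal q) (‖f k‖ * C)
      (by positivity) (fun x => ?_) s
    calc ‖f k (toLocal q x)‖ ≤ ‖f k‖ * q x := norm_toLocal q x ▸ (f k).le_opNorm _
      _ ≤ ‖f k‖ * C * seminorm a m x := by rw [mul_assoc]; gcongr; exact hqm x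
  refine ⟨m, ∑' k, C * (‖f k‖ * ‖y k‖), fun s => ?_⟩
  calc ∑ i ∈ s, a n i / a m i
      ≤ ∑ i ∈ s, (∑' k, ‖f k (e i)‖ * ‖y k‖) / a m i := by
        gcongr with i
        · exact (hpos m i).le
        · exact hdom i
    _ = ∑' k, ∑ i ∈ s, ‖f k (e i)‖ * ‖y k‖ / a m i := by
        rw [Summable.tsum_finsetSum fun i _ => (hsum i).div_const _]
        simp only [tsum_div_const]
    _ ≤ ∑' k, C * (‖f k‖ * ‖y k‖) := by
        refine Summable.tsum_le_tsum (fun k => ?_)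
          (summable_sum fun i _ => (hsum i).div_const _) (hs.mul_left C)
        calc ∑ i ∈ s, ‖f k (e i)‖ * ‖y k‖ / a m i
            = (∑ i ∈ s, ‖f k (e i)‖ / a m i) * ‖y k‖ := by
              rw [Finset.sum_mul]
              exact Finset.sum_congr rfl fun i _ => by ring
          _ ≤ (‖f k‖ * C) * ‖y k‖ := by gcongr; exact hcoef k s
          _ = C * (‖f k‖ * ‖y k‖) := by ring

end KotheSpace

/-! ### Multiplication by the index -/

namespace IsG1Matrix

variable {a : ℕ → ℕ → ℝ}

theorem apply_pos (h : IsG1Matrix a) (n i : ℕ) : 0 < a n i :=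
  (h.pos n i).trans_le (h.anti n i)

theorem exists_succ_mul_le_const (h : IsG1Matrix a) (hnuc : IsNuclearSpace ℂ (KotheSpace a))
    (n : ℕ) : ∃ K : ℝ, ∀ i : ℕ, ((i : ℝ) + 1) * a n i ≤ K := by
  obtain ⟨m, K, hK⟩ :=
    KotheSpace.sum_div_le_of_isNuclearSpace h.toIsKotheMatrix h.apply_pos hnuc n
  refine ⟨K * a m 0, fun i => ?_⟩
  rw [← div_le_iff₀ (h.apply_pos m 0)]
  refine le_trans ?_ (hK (Finset.range (i + 1)))
  -- The rows decrease, so each of the `i + 1` terms is at least `a n i / a m 0`.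
  have := Finset.card_nsmul_le_sum (Finset.range (i + 1)) (fun j => a n j / a m j)
    (a n i / a m 0) fun j hj => div_le_div₀ (h.nonneg n j)
      (h.anti' n (Nat.lt_succ_iff.mp (Finset.mem_range.mp hj))) (h.apply_pos m j)
      (h.anti' m (Nat.zero_le j))
  simpa [mul_div_assoc] using this

theorem exists_succ_mul_le (h : IsG1Matrix a) (hnuc : IsNuclearSpace ℂ (KotheSpace a)) (n : ℕ) :
    ∃ (m : ℕ) (K : ℝ), 0 ≤ K ∧ ∀ i : ℕ, ((i : ℝ) + 1) * a n i ≤ K * a m i := by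
  obtain ⟨m, -, C, hC, hsq⟩ := h.le_sq n
  obtain ⟨K, hK⟩ := h.exists_succ_mul_le_const hnuc m
  have hK0 : 0 ≤ K := le_trans (mul_nonneg (by positivity) (h.nonneg m 0)) (hK 0)
  refine ⟨m, C * K, by positivity, fun i => ?_⟩
  have hm := h.nonneg m i
  calc ((i : ℝ) + 1) * a n i ≤ ((i : ℝ) + 1) * (C * a m i ^ 2) := by gcongr; exact hsq i
    _ = C * (((i : ℝ) + 1) * a m i) * a m i := by ring
    _ ≤ C * K * a m i := by gcongr; exact hK i

/-! ### The range of `I - C` -/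

/-- The term `j = 0` of the sum is `0`, since division by zero gives zero. -/
theorem sum_div_mem (h : IsG1Matrix a) (hnuc : IsNuclearSpace ℂ (KotheSpace a)) {y : ℕ → ℂ}
    (hy : y ∈ kotheSubmodule a) :
    (fun i => ∑ j ∈ Finset.range (i + 1), y j / (j : ℂ)) ∈ kotheSubmodule a := by
  intro n
  obtain ⟨m, K, hK0, hK⟩ := h.exists_succ_mul_le hnuc n
  have hmean : Tendsto (fun i : ℕ => K * (((i + 1 : ℕ) : ℝ)⁻¹ *
      ∑ j ∈ Finset.range (i + 1), ‖(a m j : ℂ) * y j‖)) atTop (𝓝 0) := by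
    have h1 := ((tendsto_zero_iff_norm_tendsto_zero.mp (hy m)).cesaro).comp
      (tendsto_add_atTop_nat 1)
    simpa using h1.const_mul K
  refine squeeze_zero_norm (fun i => ?_) hmean
  rw [norm_mul, Complex.norm_real, Real.norm_of_nonneg (h.nonneg n i), ← mul_assoc,
    Finset.mul_sum]
  refine (mul_le_mul_of_nonneg_left (norm_sum_le _ _) (h.nonneg n i)).trans ?_
  rw [Finset.mul_sum]
  refine Finset.sum_le_sum fun j hj => ?_
  have hji : j ≤ i := Nat.lt_succ_iff.mp (Finset.mem_range.mp hj)
  have hyj : ‖y j / (j : ℂ)‖ ≤ ‖y j‖ := by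
    rw [norm_div, Complex.norm_natCast]
    rcases Nat.eq_zero_or_pos j with rfl | hj0
    · simp
    · exact div_le_self (norm_nonneg _) (by exact_mod_cast hj0)
  have hcoef : a n i ≤ K * ((i + 1 : ℕ) : ℝ)⁻¹ * a m j := by
    have h1 : a n i ≤ (K * a m i) / ((i : ℝ) + 1) := by
      rw [le_div_iff₀ (by positivity), mul_comm]; exact hK i
    refine h1.trans ?_
    rw [div_eq_mul_inv, Nat.cast_succ, mul_right_comm]
    have := h.anti' m hji
    gcongr
  rw [norm_mul, Complex.norm_real, Real.norm_of_nonneg (h.nonneg m j), ← mul_assoc]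
  exact mul_le_mul hcoef hyj (norm_nonneg _) ((h.nonneg n i).trans hcoef)

end IsG1Matrix

theorem sum_add_sum_div (y : ℕ → ℂ) (hy : y 0 = 0) (i : ℕ) :
    ∑ j ∈ Finset.range (i + 1), (y j + ∑ l ∈ Finset.range (j + 1), y l / (l : ℂ)) =
      ((i : ℂ) + 1) * ∑ l ∈ Finset.range (i + 1), y l / (l : ℂ) := by
  induction i with
  | zero => simp [hy]
  | succ i ih =>
    have hi : (i : ℂ) + 1 ≠ 0 := Nat.cast_add_one_ne_zero i
    rw [Finset.sum_range_succ, ih, Finset.sum_range_succ (fun l => y l / (l : ℂ)) (i + 1)]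
    push_cast
    field_simp
    ring

open KotheSpace in
theorem toSeq_one_sub_cesaro {a : ℕ → ℕ → ℝ} (ha : IsG1Matrix a) (x : KotheSpace a) (i : ℕ) :
    toSeq ((1 - cesaro a ha) x) i =
      toSeq x i - (∑ j ∈ Finset.range (i + 1), toSeq x j) / ((i : ℂ) + 1) := by
  rw [← toSeq_cesaro ha]
  change toSeq (x - cesaro a ha x) i = _
  rw [map_sub, Pi.sub_apply]

open KotheSpace in
theorem exists_one_sub_cesaro_eq {a : ℕ → ℕ → ℝ} (ha : IsG1Matrix a)
    (hnuc : IsNuclearSpace ℂ (KotheSpace a)) (y : KotheSpace a) (hy : toSeq y 0 = 0) :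
    ∃ x : KotheSpace a, toSeq x 0 = 0 ∧ (1 - cesaro a ha) x = y := by
  let c : KotheSpace a := ⟨_, ha.sum_div_mem hnuc y.2⟩
  have hx : ∀ i, toSeq (y + c) i =
      toSeq y i + ∑ j ∈ Finset.range (i + 1), toSeq y j / (j : ℂ) := fun i => rfl
  refine ⟨y + c, by simp [hx, hy], toSeq_injective (funext fun i => ?_)⟩
  have hi : (i : ℂ) + 1 ≠ 0 := Nat.cast_add_one_ne_zero i
  rw [toSeq_one_sub_cesaro]
  simp only [hx]
  rw [sum_add_sum_div _ hy, mul_div_cancel_left₀ _ hi, add_sub_cancel_right]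

open KotheSpace in
theorem mem_range_one_sub_cesaro_pow_succ_iff {a : ℕ → ℕ → ℝ} (ha : IsG1Matrix a)
    (hnuc : IsNuclearSpace ℂ (KotheSpace a)) (m : ℕ) (y : KotheSpace a) :
    (∃ x, ((1 - cesaro a ha) ^ (m + 1)) x = y) ↔ toSeq y 0 = 0 := by
  constructor
  · rintro ⟨x, rfl⟩
    rw [pow_succ', mul_apply_eq_comp, toSeq_one_sub_cesaro]
    simp
  · intro hy
    induction m generalizing y with
    | zero =>
      obtain ⟨x, -, hx⟩ := exists_one_sub_cesaro_eq ha hnuc y hy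
      exact ⟨x, by simpa using hx⟩
    | succ m ih =>
      obtain ⟨z, hz0, rfl⟩ := exists_one_sub_cesaro_eq ha hnuc y hy
      obtain ⟨x, rfl⟩ := ih z hz0
      exact ⟨x, by rw [pow_succ', mul_apply_eq_comp]⟩

theorem mainTheorem6 (a : ℕ → ℕ → ℝ) (ha : IsG1Matrix a)
    (hnuc : IsNuclearSpace ℂ (KotheSpace a)) (m : ℕ) :
    IsClosed (LinearMap.range
      ((((1 : KotheSpace a →L[ℂ] KotheSpace a) - cesaro a ha) ^ m :
        KotheSpace a →L[ℂ] KotheSpace a) : KotheSpace a →ₗ[ℂ] KotheSpace a) :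
      Set (KotheSpace a)) := by
  cases m with
  | zero =>
    convert isClosed_univ
    ext y
    exact ⟨fun _ => trivial, fun _ => ⟨y, by simp⟩⟩
  | succ m =>
    convert isClosed_singleton.preimage
      (KotheSpace.continuous_toSeq_apply (a := a) (n := 0) (i := 0) (ha.apply_pos 0 0))
      (t := {(0 : ℂ)}) using 1
    ext y
    exact mem_range_one_sub_cesaro_pow_succ_iff ha hnuc m y
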